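/- Let $a,b,c\in\mathbb{C}$. For a bounded operator $T$ on a complex Hilbert space, $W(T)=\{\langle Tx,x\rangle : \|x\|=1\}$ denotes its numerical range. For $t\in\mathbb{C}$ put $$S_t=\begin{pmatrix} a & t\\ c\,\overline{t} & b\end{pmatrix}\in M_2(\mathbb{C}),\qquad\text{and for } d>0 \text{ put}\qquad E_d=\bigcup_{t\in(0,d)}W(S_t).$$ For $d>0$ let $$\lambda_1(d)=\frac{a+b+\sqrt{(a-b)^2+4cd^2}}{2},\qquad \lambda_2(d)=\frac{a+b-\sqrt{(a-b)^2+4cd^2}}{2},$$ $$b_d=\frac{1}{2\sqrt2}\sqrt{|a-b|^2+2(1+|c|^2)d^2-\left|(a-b)^2+4cd^2\right|},$$ $$a_d=\frac{1}{2\sqrt2}\sqrt{|a-b|^2+2(1+|c|^2)d^2+\left|(a-b)^2+4cd^2\right|},$$ where the complex square root in $\lambda_1(d),\lambda_2(d)$ (and the one in (iii) below) may be either square root, used consistently. Here a non-degenerate elliptical disk with foci $f_1,f_2$, semi-minor axis $\beta>0$ and semi-major axis $\alpha>0$, where $\alpha^2=\beta^2+|f_1-f_2|^2/4$, is a set $D$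 with $\{z:|z-f_1|+|z-f_2|<2\alpha\}\subseteq D\subseteq\{z:|z-f_1|+|z-f_2|\le 2\alpha\}$; it is the open elliptical disk if $D$ equals the first of these sets. Then for every $d>0$ we have $\overline{E_d}=W(S_d)$. Furthermore: (i) If $|c|\neq 1$, then $a,b\in\mathrm{int}(W(S_d))=E_d$, and $E_d$ is a non-degenerate open elliptical disk with foci $\lambda_1(d),\lambda_2(d)$, semi-minor axis $b_d$ and semi-major axis $a_d$. (ii) If $a\neq b$ and $c=\frac{(a-b)^2}{|a-b|^2}$, then $E_d$ is the open line segment with endpoints $$\frac{a+b+(a-b)\sqrt{1+4kd^2}}{2}\quad\text{and}\quad\frac{a+b-(a-b)\sqrt{1+4kd^2}}{2},\qquad k=\frac{1}{|a-b|^2}.$$ (iii) If $a=b$ and $|c|=1$, then $E_d$ is the open line segment with endpoints $a+d\sqrt{c}$ and $a-d\sqrt{c}$. (iv) If $a\neq b$, $|c|=1$ and $c\neq\frac{(a-b)^2}{|a-b|^2}$, then $a,b\in\partial(W(S_d))$ and $$E_d=\mathrm{int}(W(S_d))\cup\{a,b\},$$ which is a non-degenerate elliptical disk with foci $\lambda_1(d),\lambda_2(d)$,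 semi-minor axis $b_d$ and semi-major axis $a_d$. Moreover, in this case $E_d$ is neither open nor closed in $\mathbb{C}$. -/

import Mathlib

open scoped ComplexConjugate

namespace GenQuadratic

noncomputable section

/-- The numerical range `W(T) = {⟨T x, x⟩ : ‖x‖ = 1}` of a bounded operator on a complex inner
product space. Mathlib's inner product is linear in the second variable, so the scalar
`⟨T x, x⟩` (linear in the first variable) is `inner ℂ x (T x)`. -/
def numericalRange {H : Type*} [NormedAddCommGroup H] [InnerProductSpace ℂ H]
    (T : H →L[ℂ] H) : Set ℂ :=
  {z | ∃ x : H, ‖x‖ = 1 ∧ inner ℂ x (T x) = z}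

/-- The numerical range of a square complex matrix, acting on the Euclidean space `ℂⁿ`. -/
def matrixNumericalRange {n : ℕ} (A : Matrix (Fin n) (Fin n) ℂ) : Set ℂ :=
  numericalRange (Matrix.toEuclideanCLM (n := Fin n) (𝕜 := ℂ) A)

/-- The matrix `S_d` with rows `(a, d)` and `(c * conj d, b)`. -/
def S (a b c d : ℂ) : Matrix (Fin 2) (Fin 2) ℂ :=
  !![a, d; c * conj d, b]

/-- `W(S_d)`. -/
def W (a b c d : ℂ) : Set ℂ :=
  matrixNumericalRange (S a b c d)

/-- `E_d`, the union of the sets `W(S_t)` over `t ∈ (0, d)`. -/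
def E (a b c : ℂ) (d : ℝ) : Set ℂ :=
  ⋃ t ∈ Set.Ioo (0 : ℝ) d, W a b c (t : ℂ)

/-- `b_d`. -/
def semiMinor (a b c : ℂ) (d : ℝ) : ℝ :=
  1 / (2 * √2) *
    √(‖a - b‖ ^ 2 + 2 * (1 + ‖c‖ ^ 2) * d ^ 2 - ‖(a - b) ^ 2 + 4 * c * (d : ℂ) ^ 2‖)

/-- `a_d`. -/
def semiMajor (a b c : ℂ) (d : ℝ) : ℝ :=
  1 / (2 * √2) *
    √(‖a - b‖ ^ 2 + 2 * (1 + ‖c‖ ^ 2) * d ^ 2 + ‖(a - b) ^ 2 + 4 * c * (d : ℂ) ^ 2‖)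

/-- `β` and `α` are the semi-minor and semi-major axes of a non-degenerate ellipse in the complex
plane with foci `f₁` and `f₂` (a circle if `f₁ = f₂`). -/
structure AreSemiAxes (f₁ f₂ : ℂ) (β α : ℝ) : Prop where
  minor_pos : 0 < β
  major_pos : 0 < α
  sq_major : α ^ 2 = β ^ 2 + (dist f₁ f₂ / 2) ^ 2

/-- The open region bounded by the ellipse with foci `f₁`, `f₂` and semi-major axis `α`. -/
def openEllipticalRegion (f₁ f₂ : ℂ) (α : ℝ) : Set ℂ :=
  {z | dist z f₁ + dist z f₂ < 2 * α}

/-- The closed region bounded by the ellipse with foci `f₁`, `f₂` and semi-major axis `α`. -/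
def closedEllipticalRegion (f₁ f₂ : ℂ) (α : ℝ) : Set ℂ :=
  {z | dist z f₁ + dist z f₂ ≤ 2 * α}

/-- `D` is a non-degenerate open elliptical disk with foci `f₁`, `f₂`, semi-minor axis `β` and
semi-major axis `α`. -/
def IsOpenEllipticalDisk (D : Set ℂ) (f₁ f₂ : ℂ) (β α : ℝ) : Prop :=
  AreSemiAxes f₁ f₂ β α ∧ D = openEllipticalRegion f₁ f₂ α

/-- `D` is a non-degenerate elliptical disk (open, closed, or containing only a part of its
boundary ellipse) with foci `f₁`, `f₂`, semi-minor axis `β` and semi-major axis `α`. -/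
def IsEllipticalDisk (D : Set ℂ) (f₁ f₂ : ℂ) (β α : ℝ) : Prop :=
  AreSemiAxes f₁ f₂ β α ∧
    openEllipticalRegion f₁ f₂ α ⊆ D ∧ D ⊆ closedEllipticalRegion f₁ f₂ α

end

end GenQuadratic

/-!
In the coordinates `u = |x₁|² - |x₂|²`, `w = 2 x̄₁ x₂` of a unit vector `x`, which run through the
unit sphere of `ℝ × ℂ`, the number `⟨S_t x, x⟩` is `m + L_t (u, w)`, where `m = (a + b) / 2` and
`L_t (u, w) = u (a - b) / 2 + w t / 2 + w̄ c t / 2` (`W_eq_image_sphere`). A real-linear map from a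
three-dimensional space to `ℂ` has a nontrivial kernel, so sphere and closed ball have the same
image: `W (S_t) = m + L_t (closed ball)`.

As `L_t (u, w) = L_d (u, (t / d) w)`, the union over `t < d` is the image under `m + L_d` of the
closed ball shrunk in the `w` directions by arbitrary factors in `(0, 1)`. These shrunk balls
fill up the open ball together with the two poles `(±1, 0)`, and the poles go to `a` and `b`.
Hence `E_d = (m + L_d (open ball)) ∪ {a, b}` (`E_eq`), and the closure of `E_d` is `W (S_d)`.

For `L (u, w) = u A + w B + w̄ C` put `F = A² + 4 B C` and `σ = |A|² + 2 |B|² + 2 |C|²`. Comparing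
support functions, `L (closed ball) = {z | |z² - F| + |z|² ≤ σ}` (`mem_image_closedBall_iff`), and
if `|F| < σ` the open ball is mapped onto the set given by the strict inequality
(`mem_image_ball_iff`). With `f² = F` one has `(|z - f| + |z + f|)² = 2 |z|² + 2 |F| + 2 |z² - F|`,
so these are the elliptical disks with foci `± f`. For `L_d` the condition `|F| < σ` holds if
`|c| ≠ 1`, and for `|c| = 1` unless `c` is a positive multiple of `(a - b)²` or `a = b`. The
quantity `|z² - F| + |z|² - σ` at `z + m ∈ {a, b}` is `-(1 - |c|)² d² / 2`, which decides whether
`a` and `b` are interior points or boundary points. In the remaining cases `L_d` has rank one and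
its image is computed directly (`E_eq_openSegment`).
-/

namespace GenQuadratic

/-! ### The numerical range as the image of a ball -/

/-- The real-linear map `(u, w) ↦ u A + w B + w̄ C`, on `ℝ × ℂ` with the Euclidean norm. -/
def blochMap (A B C : ℂ) : WithLp 2 (ℝ × ℂ) →ₗ[ℝ] ℂ where
  toFun x := (x.fst : ℂ) * A + x.snd * B + conj x.snd * C
  map_add' x y := by simp; ring
  map_smul' r x := by simp; ring

lemma blochMap_apply (A B C : ℂ) (x : WithLp 2 (ℝ × ℂ)) :
    blochMap A B C x = (x.fst : ℂ) * A + x.snd * B + conj x.snd * C := rfl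

/-- Any point of the closed ball can be moved to the sphere along a kernel vector. -/
lemma image_sphere_eq_image_closedBall {V F : Type*} [NormedAddCommGroup V]
    [InnerProductSpace ℝ V] [AddCommGroup F] [Module ℝ F] (L : V →ₗ[ℝ] F)
    (hL : LinearMap.ker L ≠ ⊥) :
    L '' Metric.sphere 0 1 = L '' Metric.closedBall 0 1 := by
  apply subset_antisymm (Set.image_mono Metric.sphere_subset_closedBall)
  rintro _ ⟨x, hx, rfl⟩
  rw [mem_closedBall_zero_iff] at hx
  obtain ⟨k, hk, hk0⟩ := Submodule.exists_mem_ne_zero_of_ne_bot hL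
  have hk' : 0 < ‖k‖ := norm_pos_iff.2 hk0
  have hx2 : ‖x‖ ^ 2 ≤ 1 := by nlinarith [norm_nonneg x]
  have hdisc : 0 ≤ discrim (‖k‖ ^ 2) (2 * inner ℝ x k) (‖x‖ ^ 2 - 1) := by
    unfold discrim
    nlinarith [sq_nonneg (inner ℝ x k), mul_nonneg (sq_nonneg ‖k‖) (sub_nonneg.2 hx2)]
  -- `‖x + s • k‖² = 1` is a quadratic equation in `s`;
  -- its discriminant is nonnegative as `‖x‖ ≤ 1`.
  obtain ⟨s, hs⟩ := exists_quadratic_eq_zero (pow_pos hk' 2).ne'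
    ⟨_, (Real.mul_self_sqrt hdisc).symm⟩
  refine ⟨x + s • k, ?_, by simp [LinearMap.mem_ker.1 hk]⟩
  rw [mem_sphere_zero_iff_norm, ← sq_eq_sq₀ (norm_nonneg _) zero_le_one, norm_add_sq_real,
    inner_smul_right, norm_smul, mul_pow, Real.norm_eq_abs, sq_abs]
  linarith

lemma ker_blochMap_ne_bot (A B C : ℂ) : LinearMap.ker (blochMap A B C) ≠ ⊥ := by
  apply LinearMap.ker_ne_bot_of_finrank_lt
  rw [(WithLp.linearEquiv 2 ℝ (ℝ × ℂ)).finrank_eq]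
  simp

lemma matrixNumericalRange_fin_two (M : Matrix (Fin 2) (Fin 2) ℂ) :
    matrixNumericalRange M = {z | ∃ p q : ℂ, ‖p‖ ^ 2 + ‖q‖ ^ 2 = 1 ∧
      conj p * (M 0 0 * p + M 0 1 * q) + conj q * (M 1 0 * p + M 1 1 * q) = z} := by
  have key : ∀ x : EuclideanSpace ℂ (Fin 2),
      inner ℂ x (Matrix.toEuclideanCLM (n := Fin 2) (𝕜 := ℂ) M x) =
      conj (x 0) * (M 0 0 * x 0 + M 0 1 * x 1) + conj (x 1) * (M 1 0 * x 0 + M 1 1 * x 1) := by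
    intro x
    rw [PiLp.inner_apply]
    simp only [Fin.sum_univ_two, Matrix.ofLp_toEuclideanCLM, Matrix.mulVec, dotProduct,
      RCLike.inner_apply]
    ring
  ext z
  constructor
  · rintro ⟨x, hx, rfl⟩
    refine ⟨x 0, x 1, ?_, (key x).symm⟩
    have := EuclideanSpace.norm_sq_eq x
    rw [hx, Fin.sum_univ_two] at this
    linarith
  · rintro ⟨p, q, h, rfl⟩
    refine ⟨!₂[p, q], ?_, by rw [key]; simp⟩
    rw [← sq_eq_sq₀ (norm_nonneg _) zero_le_one, EuclideanSpace.norm_sq_eq, Fin.sum_univ_two]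
    simpa using h

/-- A unit vector `(p, q)` of `ℂ²` contributes to `W` through its Bloch coordinates
`(‖p‖² - ‖q‖², 2 p̄ q)` only, and these fill the unit sphere of `ℝ × ℂ`. -/
lemma W_eq_image_sphere (a b c : ℂ) (t : ℝ) :
    W a b c t = (fun y => (a + b) / 2 + y) ''
      (blochMap ((a - b) / 2) (t / 2) (c * t / 2) '' Metric.sphere 0 1) := by
  rw [W, matrixNumericalRange_fin_two, Set.image_image]
  ext z
  constructor
  · rintro ⟨p, q, h, rfl⟩
    have hp : conj p * p = (‖p‖ : ℂ) ^ 2 := Complex.conj_mul' p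
    have hq : conj q * q = (‖q‖ : ℂ) ^ 2 := Complex.conj_mul' q
    have h' : (‖p‖ : ℂ) ^ 2 + (‖q‖ : ℂ) ^ 2 = 1 := by exact_mod_cast h
    refine ⟨WithLp.toLp 2 (‖p‖ ^ 2 - ‖q‖ ^ 2, 2 * (conj p * q)), ?_, ?_⟩
    · rw [mem_sphere_zero_iff_norm, ← sq_eq_sq₀ (norm_nonneg _) zero_le_one,
        WithLp.prod_norm_sq_eq_of_L2]
      simp only [WithLp.toLp_fst, WithLp.toLp_snd, Real.norm_eq_abs, sq_abs, norm_mul,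
        RCLike.norm_conj, Complex.norm_ofNat]
      linear_combination (‖p‖ ^ 2 + ‖q‖ ^ 2 + 1) * h
    · simp [blochMap_apply, S, map_ofNat]
      linear_combination (-(a + b) / 2) * h' - a * hp - b * hq
  · rintro ⟨x, hx, rfl⟩
    rw [mem_sphere_zero_iff_norm, ← sq_eq_sq₀ (norm_nonneg _) zero_le_one,
        WithLp.prod_norm_sq_eq_of_L2] at hx
    generalize hu : x.fst = u at hx
    generalize hw : x.snd = w at hx
    rw [Real.norm_eq_abs, sq_abs, one_pow] at hx
    have hu1 : -1 ≤ u := by nlinarith [sq_nonneg ‖w‖]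
    rcases hu1.eq_or_lt with rfl | hu1
    · have hw0 : w = 0 := by
        rw [← norm_eq_zero, ← sq_eq_zero_iff]; linarith
      refine ⟨0, 1, by simp, ?_⟩
      simp [blochMap_apply, S, hu, hw, hw0]
      ring
    -- Away from the pole `u = -1` the vector is chosen with a positive first entry `r`.
    · obtain ⟨r, hr, hr2⟩ : ∃ r : ℝ, 0 < r ∧ 2 * r ^ 2 = 1 + u :=
        ⟨√((1 + u) / 2), Real.sqrt_pos.2 (by linarith),
          by rw [Real.sq_sqrt (by linarith)]; ring⟩
      have hrc : (r : ℂ) ≠ 0 := by exact_mod_cast hr.ne'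
      have hr2' : 2 * (r : ℂ) ^ 2 = 1 + u := by exact_mod_cast hr2
      have hwn : ‖w‖ ^ 2 = 4 * r ^ 2 * (1 - r ^ 2) := by
        linear_combination hx + (2 * r ^ 2 - 1 + u) * hr2
      have hww : w * conj w = 4 * (r : ℂ) ^ 2 * (1 - r ^ 2) := by
        rw [Complex.mul_conj']
        exact_mod_cast hwn
      refine ⟨r, w / (2 * r), ?_, ?_⟩
      · simp only [norm_div, norm_mul, Complex.norm_real, Real.norm_eq_abs, abs_of_pos hr,
          Complex.norm_ofNat, div_pow, hwn]
        field_simp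
        ring
      · have hwc : conj w / (2 * r) * (b * (w / (2 * r))) = b * (1 - r ^ 2) := by
          field_simp
          linear_combination b * hww
        simp only [blochMap_apply, S, hu, hw, map_div₀, map_mul, map_ofNat, Complex.conj_ofReal,
          Matrix.of_apply, Matrix.cons_val]
        rw [mul_add (conj w / (2 * r)), hwc]
        field_simp
        linear_combination (a - b) * hr2'

lemma W_eq_image_closedBall (a b c : ℂ) (t : ℝ) :
    W a b c t = (fun y => (a + b) / 2 + y) ''
      (blochMap ((a - b) / 2) (t / 2) (c * t / 2) '' Metric.closedBall 0 1) := by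
  rw [W_eq_image_sphere, image_sphere_eq_image_closedBall _ (ker_blochMap_ne_bot _ _ _)]

/-! ### Images of balls in terms of foci -/

/-- The vector representing the functional `x ↦ Re (ω L x)` on `ℝ × ℂ`, for `L = blochMap A B C`;
the support function of `L (closed ball)` in the direction of `ω̄` is the norm of this vector. -/
def supportVector (A B C ω : ℂ) : WithLp 2 (ℝ × ℂ) :=
  WithLp.toLp 2 ((ω * A).re, conj (ω * B) + ω * C)

lemma re_mul_blochMap (A B C ω : ℂ) (x : WithLp 2 (ℝ × ℂ)) :
    (ω * blochMap A B C x).re = inner ℝ (supportVector A B C ω) x := by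
  rw [WithLp.prod_inner_apply]
  simp [blochMap_apply, supportVector, Complex.inner]
  ring

lemma two_mul_sq_re_mul (ω z : ℂ) :
    2 * (ω * z).re ^ 2 = ‖ω‖ ^ 2 * ‖z‖ ^ 2 + (ω ^ 2 * z ^ 2).re := by
  rw [Complex.sq_norm, Complex.sq_norm, Complex.normSq_apply, Complex.normSq_apply]
  simp [sq]
  ring

lemma two_mul_sq_norm_supportVector (A B C ω : ℂ) :
    2 * ‖supportVector A B C ω‖ ^ 2 =
      ‖ω‖ ^ 2 * (‖A‖ ^ 2 + 2 * ‖B‖ ^ 2 + 2 * ‖C‖ ^ 2) + (ω ^ 2 * (A ^ 2 + 4 * B * C)).re := by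
  rw [WithLp.prod_norm_sq_eq_of_L2]
  simp only [supportVector, WithLp.toLp_fst, WithLp.toLp_snd, Real.norm_eq_abs, sq_abs,
    Complex.sq_norm, Complex.normSq_apply]
  simp [sq]
  ring

/-- The half-plane conditions of the support function, written so that the right side depends
on `ω` through `‖ω‖` only. Taking the supremum of the left side over the unit vectors `ω` turns
`Re (ω² y)` into `‖y‖`. -/
lemma sq_re_mul_le_iff (A B C ω z : ℂ) (r : ℝ) :
    (ω * z).re ^ 2 ≤ r ^ 2 * ‖supportVector A B C ω‖ ^ 2 ↔
      (ω ^ 2 * (z ^ 2 - r ^ 2 * (A ^ 2 + 4 * B * C))).re + ‖ω‖ ^ 2 * ‖z‖ ^ 2 ≤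
        ‖ω‖ ^ 2 * (r ^ 2 * (‖A‖ ^ 2 + 2 * ‖B‖ ^ 2 + 2 * ‖C‖ ^ 2)) := by
  have h1 := two_mul_sq_re_mul ω z
  have h2 := two_mul_sq_norm_supportVector A B C ω
  have h3 : (ω ^ 2 * (z ^ 2 - r ^ 2 * (A ^ 2 + 4 * B * C))).re =
      (ω ^ 2 * z ^ 2).re - r ^ 2 * (ω ^ 2 * (A ^ 2 + 4 * B * C)).re := by
    rw [← Complex.re_ofReal_mul, ← Complex.sub_re]
    push_cast
    ring_nf
  have h4 : 2 * (r ^ 2 * ‖supportVector A B C ω‖ ^ 2) =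
      r ^ 2 * (2 * ‖supportVector A B C ω‖ ^ 2) := by ring
  rw [h3, ← mul_le_mul_iff_right₀ (two_pos (α := ℝ)), h4, h1, h2]
  constructor <;> intro h <;> linarith

/-- The closed elliptical range theorem: Cauchy–Schwarz gives one inclusion, separation of a point
from the compact convex image the other. -/
lemma mem_image_closedBall_iff (A B C z : ℂ) {r : ℝ} (hr : 0 ≤ r) :
    z ∈ blochMap A B C '' Metric.closedBall 0 r ↔
      ‖z ^ 2 - r ^ 2 * (A ^ 2 + 4 * B * C)‖ + ‖z‖ ^ 2 ≤
        r ^ 2 * (‖A‖ ^ 2 + 2 * ‖B‖ ^ 2 + 2 * ‖C‖ ^ 2) := by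
  constructor
  · rintro ⟨x, hx, rfl⟩
    rw [mem_closedBall_zero_iff] at hx
    have key (ω : ℂ) := (sq_re_mul_le_iff A B C ω (blochMap A B C x) r).1 (by
      rw [re_mul_blochMap, ← sq_abs, ← mul_pow]
      gcongr
      exact (abs_real_inner_le_norm _ _).trans (by rw [mul_comm]; gcongr))
    set y := blochMap A B C x ^ 2 - r ^ 2 * (A ^ 2 + 4 * B * C) with hy
    rcases eq_or_ne y 0 with hy0 | hy0
    · simpa [hy0] using key 1
    -- The direction with `ω² y = |y|²`, in which the support condition is sharpest.
    · obtain ⟨ω, hω⟩ := IsAlgClosed.exists_pow_nat_eq (conj y) (n := 2) two_pos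
      have hn : ‖ω‖ ^ 2 = ‖y‖ := by rw [← norm_pow, hω, RCLike.norm_conj]
      have h := key ω
      rw [hω, hn, Complex.conj_mul', ← Complex.ofReal_pow, Complex.ofReal_re, sq ‖y‖, ← mul_add]
        at h
      exact le_of_mul_le_mul_left h (norm_pos_iff.2 hy0)
  · contrapose!
    intro hz
    obtain ⟨f, u, hf, hu⟩ := geometric_hahn_banach_closed_point
      ((convex_closedBall (0 : WithLp 2 (ℝ × ℂ)) r).linear_image (blochMap A B C))
      ((isCompact_closedBall _ _).image
        (blochMap A B C).continuous_of_finiteDimensional).isClosed hz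
    -- Every real functional on `ℂ` is `y ↦ Re (ω y)` for some `ω`.
    set ω : ℂ := ⟨f 1, -f Complex.I⟩ with hω
    have hfω (y : ℂ) : f y = (ω * y).re := by
      conv_lhs => rw [← Complex.re_add_im y, ← mul_one (y.re : ℂ), ← Complex.real_smul,
        ← Complex.real_smul, map_add, map_smul, map_smul]
      simp [hω, mul_comm]
    set v := supportVector A B C ω with hv
    have h1 : r * ‖v‖ < (ω * z).re := by
      rw [← hfω]
      -- The functional attains its maximum on the closed ball at a multiple of the support vector.
      -- If this vector is `0`, then `r / 0 = 0` makes the point `0`, which serves as well.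
      refine lt_of_le_of_lt ?_ ((hf _ ⟨(r / ‖v‖) • v, ?_, rfl⟩).trans hu)
      · rw [hfω, re_mul_blochMap, inner_smul_right, ← hv, real_inner_self_eq_norm_sq]
        rcases eq_or_ne ‖v‖ 0 with h | h
        · simp [h]
        · apply le_of_eq
          field_simp
      · rw [mem_closedBall_zero_iff, norm_smul, norm_div, norm_norm, Real.norm_of_nonneg hr]
        rcases eq_or_ne ‖v‖ 0 with h | h
        · simpa [h] using hr
        · rw [div_mul_cancel₀ _ h]
    by_contra! h
    have h2 : (ω * z).re ^ 2 ≤ r ^ 2 * ‖v‖ ^ 2 := by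
      rw [sq_re_mul_le_iff]
      have h3 := mul_le_mul_of_nonneg_left h (sq_nonneg ‖ω‖)
      have h4 := Complex.re_le_norm (ω ^ 2 * (z ^ 2 - r ^ 2 * (A ^ 2 + 4 * B * C)))
      rw [norm_mul, norm_pow] at h4
      linarith
    rw [← mul_pow] at h2
    exact h1.not_ge (le_of_sq_le_sq h2 (by positivity))

/-- The open ball is the union of the closed balls of radii `r < 1`. The hypothesis says that the
ellipse is non-degenerate, that is, that the map has rank two. -/
lemma mem_image_ball_iff {A B C : ℂ}
    (h : ‖A ^ 2 + 4 * B * C‖ < ‖A‖ ^ 2 + 2 * ‖B‖ ^ 2 + 2 * ‖C‖ ^ 2) (z : ℂ) :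
    z ∈ blochMap A B C '' Metric.ball 0 1 ↔
      ‖z ^ 2 - (A ^ 2 + 4 * B * C)‖ + ‖z‖ ^ 2 < ‖A‖ ^ 2 + 2 * ‖B‖ ^ 2 + 2 * ‖C‖ ^ 2 := by
  constructor
  · rintro ⟨x, hx, rfl⟩
    rw [mem_ball_zero_iff] at hx
    have h1 := (mem_image_closedBall_iff A B C (blochMap A B C x) (norm_nonneg x)).1
      ⟨x, by simp, rfl⟩
    set z := blochMap A B C x
    set F := A ^ 2 + 4 * B * C
    have h2 : ‖z ^ 2 - F‖ ≤ ‖z ^ 2 - (‖x‖ : ℂ) ^ 2 * F‖ + (1 - ‖x‖ ^ 2) * ‖F‖ := by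
      have h3 : z ^ 2 - F = (z ^ 2 - (‖x‖ : ℂ) ^ 2 * F) - ((1 - ‖x‖ ^ 2 : ℝ) : ℂ) * F := by
        push_cast; ring
      rw [h3]
      refine (norm_sub_le _ _).trans_eq ?_
      rw [norm_mul, Complex.norm_real, Real.norm_of_nonneg (by nlinarith [norm_nonneg x])]
    have h4 : 0 < 1 - ‖x‖ ^ 2 := by nlinarith [norm_nonneg x]
    nlinarith [mul_lt_mul_of_pos_left h h4]
  -- By continuity the strict inequality survives for the closed ball of some radius `r < 1`.
  · intro hz
    have hc : ∀ᶠ r : ℝ in nhdsWithin 1 (Set.Iio 1),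
        ‖z ^ 2 - (r : ℂ) ^ 2 * (A ^ 2 + 4 * B * C)‖ + ‖z‖ ^ 2 <
        r ^ 2 * (‖A‖ ^ 2 + 2 * ‖B‖ ^ 2 + 2 * ‖C‖ ^ 2) := by
      apply Filter.Eventually.filter_mono nhdsWithin_le_nhds
      apply ContinuousAt.eventually_lt (by fun_prop) (by fun_prop)
      simpa using hz
    have hc0 : ∀ᶠ r : ℝ in nhdsWithin 1 (Set.Iio 1), 0 ≤ r :=
      Filter.Eventually.filter_mono nhdsWithin_le_nhds (eventually_ge_nhds one_pos)
    obtain ⟨r, hr, hr0, hr1⟩ := (hc.and (hc0.and self_mem_nhdsWithin)).exists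
    exact Set.image_mono (Metric.closedBall_subset_ball hr1)
      ((mem_image_closedBall_iff A B C z hr0).2 hr.le)

/-- Squaring the sum of the distances to the foci and applying the parallelogram law removes the
choice of the square root `s`. -/
lemma dist_add_dist_lt_iff (m s z : ℂ) {α σ : ℝ} (hα : 0 ≤ α)
    (hασ : 4 * α ^ 2 = 2 * σ + 2 * ‖(s / 2) ^ 2‖) :
    dist z (m + s / 2) + dist z (m - s / 2) < 2 * α ↔
      ‖(z - m) ^ 2 - (s / 2) ^ 2‖ + ‖z - m‖ ^ 2 < σ := by
  have h1 := parallelogram_law_with_norm ℝ (z - m) (s / 2)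
  have h2 : ‖(z - m) ^ 2 - (s / 2) ^ 2‖ = ‖z - m + s / 2‖ * ‖z - m - s / 2‖ := by
    rw [← norm_mul]; ring_nf
  rw [dist_eq_norm, dist_eq_norm, ← sq_lt_sq₀ (by positivity) (by positivity), mul_pow, h2]
  rw [norm_pow] at hασ
  rw [show z - (m + s / 2) = z - m - s / 2 by ring, show z - (m - s / 2) = z - m + s / 2 by ring]
  constructor <;> intro h <;> nlinarith

/-! ### The sets `W` and `E` -/

/-- The function whose sublevel sets `{≤ 0}` and, in the non-degenerate case, `{< 0}` are `W (S_d)`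
and its interior. It depends on the foci only through the square of their half-difference. -/
noncomputable def ellipseDefect (a b c : ℂ) (d : ℝ) (z : ℂ) : ℝ :=
  ‖(z - (a + b) / 2) ^ 2 - ((a - b) ^ 2 + 4 * c * (d : ℂ) ^ 2) / 4‖ + ‖z - (a + b) / 2‖ ^ 2 -
    (‖a - b‖ ^ 2 + 2 * (1 + ‖c‖ ^ 2) * d ^ 2) / 4

lemma continuous_ellipseDefect (a b c : ℂ) (d : ℝ) : Continuous (ellipseDefect a b c d) := by
  unfold ellipseDefect
  fun_prop

/-- The image of the open unit ball under the affine map that takes the closed ball onto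
`W (S_d)`. -/
def ballPart (a b c : ℂ) (d : ℝ) : Set ℂ :=
  (fun y => (a + b) / 2 + y) ''
    (blochMap ((a - b) / 2) (d / 2) (c * d / 2) '' Metric.ball 0 1)

/-- The radicand of the semi-minor axis is positive, that is, `W (S_d)` is not a segment. -/
def NonDegenerate (a b c : ℂ) (d : ℝ) : Prop :=
  ‖(a - b) ^ 2 + 4 * c * (d : ℂ) ^ 2‖ < ‖a - b‖ ^ 2 + 2 * (1 + ‖c‖ ^ 2) * d ^ 2

lemma blochMap_S_focus (a b c : ℂ) (d : ℝ) :
    ((a - b) / 2) ^ 2 + 4 * ((d : ℂ) / 2) * (c * d / 2) =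
      ((a - b) ^ 2 + 4 * c * (d : ℂ) ^ 2) / 4 := by
  ring

lemma blochMap_S_frobenius (a b c : ℂ) (d : ℝ) :
    ‖(a - b) / 2‖ ^ 2 + 2 * ‖(d : ℂ) / 2‖ ^ 2 + 2 * ‖c * d / 2‖ ^ 2 =
      (‖a - b‖ ^ 2 + 2 * (1 + ‖c‖ ^ 2) * d ^ 2) / 4 := by
  simp only [norm_div, norm_mul, Complex.norm_real, Real.norm_eq_abs, Complex.norm_ofNat,
    div_pow, mul_pow, sq_abs]
  ring

lemma mem_add_image {m z : ℂ} {s : Set ℂ} : z ∈ (fun y => m + y) '' s ↔ z - m ∈ s := by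
  simp [Set.image_add_left, sub_eq_neg_add]

lemma mem_W_iff (a b c z : ℂ) (d : ℝ) : z ∈ W a b c d ↔ ellipseDefect a b c d z ≤ 0 := by
  rw [W_eq_image_closedBall, mem_add_image, mem_image_closedBall_iff _ _ _ _ zero_le_one,
    blochMap_S_frobenius, ellipseDefect, sub_nonpos, ← blochMap_S_focus]
  simp

lemma mem_ballPart_iff {a b c : ℂ} {d : ℝ} (h : NonDegenerate a b c d) (z : ℂ) :
    z ∈ ballPart a b c d ↔ ellipseDefect a b c d z < 0 := by
  rw [ballPart, mem_add_image, mem_image_ball_iff, blochMap_S_frobenius, ellipseDefect, sub_neg,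
    ← blochMap_S_focus]
  rw [blochMap_S_frobenius, blochMap_S_focus, norm_div, Complex.norm_ofNat]
  exact div_lt_div_of_pos_right h four_pos

lemma closure_ballPart (a b c : ℂ) (d : ℝ) : closure (ballPart a b c d) = W a b c d := by
  rw [ballPart, W_eq_image_closedBall, Set.image_image, Set.image_image,
    ← closure_ball (0 : WithLp 2 (ℝ × ℂ)) one_ne_zero]
  have hL := (blochMap ((a - b) / 2) (d / 2) (c * d / 2)).continuous_of_finiteDimensional
  refine (image_closure_of_isCompact ?_ ?_).symm
  · rw [closure_ball (0 : WithLp 2 (ℝ × ℂ)) one_ne_zero]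
    exact isCompact_closedBall _ _
  · exact (continuous_const.add hL).continuousOn

lemma convex_ballPart (a b c : ℂ) (d : ℝ) : Convex ℝ (ballPart a b c d) :=
  ((convex_ball _ _).linear_image _).translate _

lemma ballPart_nonempty (a b c : ℂ) (d : ℝ) : (ballPart a b c d).Nonempty :=
  (((Metric.nonempty_ball).2 one_pos).image _).image _

lemma interior_W {a b c : ℂ} {d : ℝ} (h : NonDegenerate a b c d) :
    interior (W a b c d) = ballPart a b c d := by
  have ho : IsOpen (ballPart a b c d) := by
    rw [show ballPart a b c d = {z | ellipseDefect a b c d z < 0} from Set.ext (mem_ballPart_iff h)]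
    exact isOpen_lt (continuous_ellipseDefect a b c d) continuous_const
  rw [← closure_ballPart,
    (convex_ballPart a b c d).interior_closure_eq_interior_of_nonempty_interior,
    ho.interior_eq]
  rw [ho.interior_eq]
  exact ballPart_nonempty a b c d

lemma left_mem_W (a b c : ℂ) (t : ℝ) : a ∈ W a b c t := by
  rw [W, matrixNumericalRange_fin_two]
  exact ⟨1, 0, by simp, by simp [S]⟩

lemma right_mem_W (a b c : ℂ) (t : ℝ) : b ∈ W a b c t := by
  rw [W, matrixNumericalRange_fin_two]
  exact ⟨0, 1, by simp, by simp [S]⟩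

/-- Shrinking the off-diagonal entries of the matrix amounts to shrinking the `ℂ` coordinate of the
ball. -/
lemma blochMap_rescale (A : ℂ) (c : ℂ) (d s u : ℝ) (w : ℂ) :
    blochMap A ((s * d : ℝ) / 2) (c * (s * d : ℝ) / 2) (WithLp.toLp 2 (u, w)) =
      blochMap A (d / 2) (c * d / 2) (WithLp.toLp 2 (u, (s : ℂ) * w)) := by
  simp [blochMap_apply]
  ring

/-- The union over `t < d` is the image of the open ball, together with the images `a` and `b` of
its two poles. -/
lemma E_eq (a b c : ℂ) {d : ℝ} (hd : 0 < d) : E a b c d = ballPart a b c d ∪ {a, b} := by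
  have norm_sq (u : ℝ) (w : ℂ) : ‖WithLp.toLp 2 (u, w)‖ ^ 2 = u ^ 2 + ‖w‖ ^ 2 := by
    rw [WithLp.prod_norm_sq_eq_of_L2]; simp
  apply subset_antisymm
  · intro z hz
    simp only [E, Set.mem_iUnion] at hz
    obtain ⟨t, ⟨ht0, htd⟩, hz⟩ := hz
    obtain ⟨s, hs0, hs1, rfl⟩ : ∃ s : ℝ, 0 < s ∧ s < 1 ∧ t = s * d :=
      ⟨t / d, div_pos ht0 hd, (div_lt_one hd).2 htd, by field_simp⟩
    rw [W_eq_image_closedBall] at hz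
    obtain ⟨_, ⟨⟨⟨u, w⟩⟩, hx, rfl⟩, rfl⟩ := hz
    rw [mem_closedBall_zero_iff, ← sq_le_sq₀ (norm_nonneg _) zero_le_one, norm_sq, one_pow] at hx
    rw [blochMap_rescale]
    by_cases h : u ^ 2 + ‖(s : ℂ) * w‖ ^ 2 < 1
    · left
      refine ⟨_, ⟨_, ?_, rfl⟩, rfl⟩
      rwa [mem_ball_zero_iff, ← sq_lt_sq₀ (norm_nonneg _) zero_le_one, norm_sq, one_pow]
    -- Shrinking `w` leaves the point on the sphere only if `w = 0`, that is, at a pole.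
    · right
      rw [norm_mul, Complex.norm_real, Real.norm_of_nonneg hs0.le, mul_pow] at h
      have hs2 : s ^ 2 < 1 := by nlinarith
      have hw : w = 0 := by
        rw [← norm_eq_zero, ← sq_eq_zero_iff]
        nlinarith [sq_nonneg ‖w‖]
      subst hw
      have hu : u ^ 2 = 1 := by
        rw [norm_zero] at h hx
        linarith
      rcases mul_self_eq_one_iff.1 ((sq u).symm.trans hu) with rfl | rfl
      · left
        simp [blochMap_apply]; ring
      · right
        simp [blochMap_apply]; ring
  · rintro z (⟨_, ⟨⟨⟨u, w⟩⟩, hx, rfl⟩, rfl⟩ | rfl | rfl)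
    · rw [mem_ball_zero_iff] at hx
      set n := ‖WithLp.toLp 2 (u, w)‖ with hn
      have hn2 := norm_sq u w
      rw [← hn] at hn2
      have hn0 : 0 ≤ n := norm_nonneg _
      -- Any `s ∈ [n, 1)` works, since `‖(u, w / s)‖ ≤ n / s ≤ 1`.
      obtain ⟨s, hs0, hs1, hns⟩ : ∃ s : ℝ, 0 < s ∧ s < 1 ∧ n ≤ s :=
        ⟨(1 + n) / 2, by linarith, by linarith, by linarith⟩
      have hs : (s : ℂ) ≠ 0 := by exact_mod_cast hs0.ne'
      simp only [E, Set.mem_iUnion]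
      refine ⟨s * d, ⟨by positivity, by nlinarith⟩, ?_⟩
      rw [W_eq_image_closedBall]
      refine ⟨_, ⟨WithLp.toLp 2 (u, w / s), ?_, rfl⟩, ?_⟩
      · rw [mem_closedBall_zero_iff, ← sq_le_sq₀ (norm_nonneg _) zero_le_one, norm_sq, norm_div,
          Complex.norm_real, Real.norm_of_nonneg hs0.le, div_pow]
        have h1 : u ^ 2 ≤ u ^ 2 / s ^ 2 := le_div_self (sq_nonneg u) (by positivity) (by nlinarith)
        have h2 : n ^ 2 / s ^ 2 ≤ 1 := by
          rw [div_le_one (by positivity)]; gcongr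
        rw [hn2, add_div] at h2
        linarith
      · simp only
        rw [blochMap_rescale, mul_div_cancel₀ _ hs]
    all_goals
      simp only [E, Set.mem_iUnion]
      exact ⟨d / 2, ⟨by positivity, by linarith⟩, by first | apply left_mem_W | apply right_mem_W⟩

lemma closure_E (a b c : ℂ) {d : ℝ} (hd : 0 < d) : closure (E a b c d) = W a b c d := by
  rw [E_eq a b c hd, closure_union, closure_ballPart, Set.union_eq_left]
  rw [(Set.toFinite {a, b}).isClosed.closure_eq]
  rintro z (rfl | rfl)
  · apply left_mem_W
  · apply right_mem_W

lemma nonDegenerate_of_norm_ne_one (a b : ℂ) {c : ℂ} {d : ℝ} (hd : 0 < d) (hc : ‖c‖ ≠ 1) :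
    NonDegenerate a b c d := by
  have h1 : ‖(a - b) ^ 2 + 4 * c * (d : ℂ) ^ 2‖ ≤ ‖a - b‖ ^ 2 + 4 * ‖c‖ * d ^ 2 := by
    refine (norm_add_le _ _).trans_eq ?_
    simp
  have h2 : 0 < (1 - ‖c‖) ^ 2 * d ^ 2 := by
    have := sub_ne_zero.2 hc.symm
    positivity
  unfold NonDegenerate
  linarith

/-- For `‖c‖ = 1` the triangle inequality is strict unless `(a - b)²` and `c` have the same
argument. -/
lemma nonDegenerate_of_ne {a b c : ℂ} {d : ℝ} (hd : 0 < d) (hab : a ≠ b) (hc : ‖c‖ = 1)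
    (h : c ≠ (a - b) ^ 2 / ((‖a - b‖ ^ 2 : ℝ) : ℂ)) : NonDegenerate a b c d := by
  have h0 : 0 < ‖a - b‖ := norm_pos_iff.2 (sub_ne_zero.2 hab)
  have h1 : ‖(a - b) ^ 2 + 4 * c * (d : ℂ) ^ 2‖ < ‖(a - b) ^ 2‖ + ‖4 * c * (d : ℂ) ^ 2‖ := by
    apply norm_add_lt_of_not_sameRay
    rw [sameRay_iff_norm_smul_eq]
    intro h1
    apply h
    simp only [norm_pow, norm_mul, Complex.norm_real, Real.norm_eq_abs, abs_of_pos hd, hc,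
      Complex.norm_ofNat, Complex.real_smul] at h1
    have hd' : (d : ℂ) ^ 2 ≠ 0 := by exact_mod_cast (pow_pos hd 2).ne'
    have h0' : (‖a - b‖ : ℂ) ≠ 0 := by exact_mod_cast h0.ne'
    push_cast at h1 ⊢
    rw [eq_div_iff (pow_ne_zero 2 h0')]
    apply mul_right_cancel₀ hd'
    linear_combination h1 / 4
  unfold NonDegenerate
  refine h1.trans_eq ?_
  rw [norm_pow, norm_mul, norm_mul, norm_pow, Complex.norm_real, hc, Real.norm_eq_abs, sq_abs,
    Complex.norm_ofNat]
  ring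

lemma ellipseDefect_left (a b c : ℂ) (d : ℝ) :
    ellipseDefect a b c d a = -((1 - ‖c‖) ^ 2 * d ^ 2) / 2 := by
  have h1 : (a - (a + b) / 2) ^ 2 - ((a - b) ^ 2 + 4 * c * (d : ℂ) ^ 2) / 4 =
      -(c * (d : ℂ) ^ 2) := by
    ring
  rw [ellipseDefect, h1, show a - (a + b) / 2 = (a - b) / 2 by ring]
  simp
  ring

lemma ellipseDefect_right (a b c : ℂ) (d : ℝ) :
    ellipseDefect a b c d b = -((1 - ‖c‖) ^ 2 * d ^ 2) / 2 := by
  have h1 : (b - (a + b) / 2) ^ 2 - ((a - b) ^ 2 + 4 * c * (d : ℂ) ^ 2) / 4 =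
      -(c * (d : ℂ) ^ 2) := by
    ring
  rw [ellipseDefect, h1, show b - (a + b) / 2 = -((a - b) / 2) by ring]
  simp
  ring

lemma areSemiAxes {a b c s : ℂ} {d : ℝ} (h : NonDegenerate a b c d)
    (hs : s ^ 2 = (a - b) ^ 2 + 4 * c * (d : ℂ) ^ 2) :
    AreSemiAxes ((a + b + s) / 2) ((a + b - s) / 2) (semiMinor a b c d) (semiMajor a b c d) where
  minor_pos := by
    have := sub_pos.2 h
    unfold semiMinor
    positivity
  major_pos := by
    have := (norm_nonneg _).trans_lt h
    unfold semiMajor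
    positivity
  sq_major := by
    rw [semiMajor, semiMinor, mul_pow, mul_pow, Real.sq_sqrt, Real.sq_sqrt (sub_pos.2 h).le,
      dist_eq_norm, show (a + b + s) / 2 - (a + b - s) / 2 = s by ring, ← hs, norm_pow, div_pow,
      mul_pow, Real.sq_sqrt zero_le_two]
    · ring
    · positivity

lemma ellipseDefect_lt_zero_iff {a b c s : ℂ} {d : ℝ}
    (hs : s ^ 2 = (a - b) ^ 2 + 4 * c * (d : ℂ) ^ 2) (z : ℂ) :
    ellipseDefect a b c d z < 0 ↔
      z ∈ openEllipticalRegion ((a + b + s) / 2) ((a + b - s) / 2) (semiMajor a b c d) := by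
  rw [openEllipticalRegion, Set.mem_ofPred_eq, add_div (a + b), sub_div (a + b),
    dist_add_dist_lt_iff _ _ _ (σ := (‖a - b‖ ^ 2 + 2 * (1 + ‖c‖ ^ 2) * d ^ 2) / 4),
    ellipseDefect, sub_neg, ← hs, div_pow]
  · norm_num
  · unfold semiMajor; positivity
  · rw [semiMajor, mul_pow, Real.sq_sqrt (by positivity), div_pow s, hs, norm_div, div_pow,
      mul_pow, Real.sq_sqrt zero_le_two]
    norm_num
    ring

lemma isOpenEllipticalDisk_ballPart {a b c s : ℂ} {d : ℝ} (h : NonDegenerate a b c d)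
    (hs : s ^ 2 = (a - b) ^ 2 + 4 * c * (d : ℂ) ^ 2) :
    IsOpenEllipticalDisk (ballPart a b c d) ((a + b + s) / 2) ((a + b - s) / 2)
      (semiMinor a b c d) (semiMajor a b c d) :=
  ⟨areSemiAxes h hs, Set.ext fun z => (mem_ballPart_iff h z).trans (ellipseDefect_lt_zero_iff hs z)⟩

lemma isClosed_closedEllipticalRegion (f₁ f₂ : ℂ) (α : ℝ) :
    IsClosed (closedEllipticalRegion f₁ f₂ α) :=
  isClosed_le (by fun_prop) continuous_const

lemma isEllipticalDisk_E {a b c s : ℂ} {d : ℝ} (hd : 0 < d) (h : NonDegenerate a b c d)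
    (hs : s ^ 2 = (a - b) ^ 2 + 4 * c * (d : ℂ) ^ 2) :
    IsEllipticalDisk (E a b c d) ((a + b + s) / 2) ((a + b - s) / 2)
      (semiMinor a b c d) (semiMajor a b c d) := by
  have hb := (isOpenEllipticalDisk_ballPart h hs).2
  refine ⟨areSemiAxes h hs, ?_, ?_⟩
  · rw [← hb, E_eq a b c hd]
    exact Set.subset_union_left
  · refine subset_closure.trans ?_
    rw [closure_E a b c hd, ← closure_ballPart, hb]
    refine closure_minimal (fun z hz => ?_) (isClosed_closedEllipticalRegion _ _ _)
    exact le_of_lt (α := ℝ) hz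

/-- The image `p` of the equatorial point `(0, γ)` with `γ² = c` is a boundary point other than `a`
and `b`. -/
lemma exists_ellipseDefect_eq_zero {a b c : ℂ} {d : ℝ} (hd : 0 < d) (hc : ‖c‖ = 1)
    (h : c ≠ (a - b) ^ 2 / ((‖a - b‖ ^ 2 : ℝ) : ℂ)) :
    ∃ p, p ≠ a ∧ p ≠ b ∧ ellipseDefect a b c d p = 0 := by
  obtain ⟨γ, hγ⟩ := IsAlgClosed.exists_pow_nat_eq c (n := 2) two_pos
  have hγ1 : ‖γ‖ ^ 2 = 1 := by rw [← norm_pow, hγ, hc]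
  have key : (2 * d * γ) ^ 2 ≠ (a - b) ^ 2 := by
    intro h1
    have h2 : ‖a - b‖ ^ 2 = 4 * d ^ 2 := by
      rw [← norm_pow, ← h1, norm_pow, norm_mul, norm_mul, mul_pow, hγ1, Complex.norm_real,
        mul_pow, Real.norm_eq_abs, sq_abs]
      norm_num
    apply h
    have hd' : (d : ℂ) ≠ 0 := by exact_mod_cast hd.ne'
    rw [h2, ← h1, ← hγ]
    push_cast
    field_simp
    ring
  refine ⟨(a + b) / 2 + d * γ, ?_, ?_, ?_⟩
  · intro h1
    exact key (by linear_combination (2 * d * γ + (a - b)) * 2 * h1)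
  · intro h1
    exact key (by linear_combination (2 * d * γ - (a - b)) * 2 * h1)
  · have h1 : ((a + b) / 2 + d * γ - (a + b) / 2) ^ 2 - ((a - b) ^ 2 + 4 * c * (d : ℂ) ^ 2) / 4 =
        -((a - b) / 2) ^ 2 := by
      rw [← hγ]; ring
    rw [ellipseDefect, h1, add_sub_cancel_left, norm_neg, norm_mul, mul_pow, hγ1, hc,
      Complex.norm_real, Real.norm_eq_abs, sq_abs, norm_pow, norm_div, div_pow]
    norm_num
    ring

/-- If `c = γ²` and `a - b` is a real multiple of `γ`, the affine map depends on the real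
coordinates `u` and `Re (γ̄ w)` only, and takes its values in a line of direction `γ`. -/
lemma E_eq_openSegment {a b c γ : ℂ} {d r R : ℝ} (hd : 0 < d) (hγ : ‖γ‖ = 1) (hc : c = γ ^ 2)
    (hab : a - b = 2 * r * γ) (hR : 0 < R) (hRr : R ^ 2 = r ^ 2 + d ^ 2) :
    E a b c d = openSegment ℝ ((a + b) / 2 + R * γ) ((a + b) / 2 - R * γ) := by
  have hγγ : conj γ * γ = 1 := by rw [Complex.conj_mul', hγ]; simp
  have hB : ∀ x : WithLp 2 (ℝ × ℂ), blochMap ((a - b) / 2) (d / 2) (c * d / 2) x =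
      ((r * x.fst + d * (conj γ * x.snd).re : ℝ) : ℂ) * γ := by
    intro x
    have h1 : 2 * ((conj γ * x.snd).re : ℂ) = conj γ * x.snd + γ * conj x.snd := by
      have := Complex.add_conj (conj γ * x.snd)
      simp only [map_mul, Complex.conj_conj] at this
      rw [this]; push_cast; ring
    rw [blochMap_apply, hab, hc]
    push_cast
    linear_combination (-(d * γ) / 2) * h1 + (-(d * x.snd) / 2) * hγγ
  have hseg : openSegment ℝ ((a + b) / 2 + R * γ) ((a + b) / 2 - R * γ) =
      (fun v : ℝ => (a + b) / 2 + (v : ℂ) * γ) '' Set.Ioo (-R) R := by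
    rw [openSegment_eq_image_lineMap]
    ext z
    constructor
    · rintro ⟨θ, ⟨h0, h1⟩, rfl⟩
      refine ⟨R * (1 - 2 * θ), ⟨by nlinarith, by nlinarith⟩, ?_⟩
      simp [AffineMap.lineMap_apply]
      ring
    · rintro ⟨v, ⟨h0, h1⟩, rfl⟩
      refine ⟨(R - v) / (2 * R), ⟨by apply div_pos <;> linarith,
        by rw [div_lt_one (by positivity)]; linarith⟩, ?_⟩
      have : (R : ℂ) ≠ 0 := by exact_mod_cast hR.ne'
      simp [AffineMap.lineMap_apply]
      field_simp
      ring
  have hrR : |r| < R := by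
    rw [← sq_lt_sq₀ (abs_nonneg _) hR.le, sq_abs, hRr]
    have := pow_pos hd 2
    linarith
  rw [abs_lt] at hrR
  rw [E_eq a b c hd, hseg, ballPart, Set.image_image]
  apply subset_antisymm
  · rintro z (⟨x, hx, rfl⟩ | rfl | rfl)
    · refine ⟨_, ?_, congrArg _ (hB x).symm⟩
      rw [mem_ball_zero_iff, ← sq_lt_sq₀ (norm_nonneg _) zero_le_one,
        WithLp.prod_norm_sq_eq_of_L2, Real.norm_eq_abs, sq_abs, one_pow] at hx
      have h1 : (conj γ * x.snd).re ^ 2 ≤ ‖x.snd‖ ^ 2 := by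
        rw [← sq_abs]
        gcongr
        refine (Complex.abs_re_le_norm _).trans_eq ?_
        rw [norm_mul, RCLike.norm_conj, hγ, one_mul]
      rw [Set.mem_Ioo, ← abs_lt, ← sq_lt_sq₀ (abs_nonneg _) hR.le, sq_abs, hRr]
      set v := (conj γ * x.snd).re
      have h2 : 0 < r ^ 2 + d ^ 2 := by positivity
      have h3 : x.fst ^ 2 + v ^ 2 < 1 := by linarith
      -- Cauchy–Schwarz for `(r, d)` and `(u, v)`.
      nlinarith [sq_nonneg (r * v - d * x.fst)]
    · exact ⟨r, hrR, by simp only; linear_combination (-1 / 2 : ℂ) * hab⟩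
    · exact ⟨-r, ⟨by linarith [hrR.2], by linarith [hrR.1]⟩, by
        push_cast; linear_combination (1 / 2 : ℂ) * hab⟩
  · rintro _ ⟨v, hv, rfl⟩
    left
    -- The preimage of least norm, a multiple of `(r, d γ)`.
    refine ⟨WithLp.toLp 2 (v * r / R ^ 2, (v * d / R ^ 2 : ℝ) * γ), ?_, ?_⟩
    · rw [mem_ball_zero_iff, ← sq_lt_sq₀ (norm_nonneg _) zero_le_one,
        WithLp.prod_norm_sq_eq_of_L2]
      rw [Set.mem_Ioo, ← abs_lt, ← sq_lt_sq₀ (abs_nonneg _) hR.le, sq_abs] at hv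
      simp only [WithLp.toLp_fst, WithLp.toLp_snd, norm_mul, hγ, Complex.norm_real, mul_one,
        Real.norm_eq_abs, sq_abs]
      have : (v * r / R ^ 2) ^ 2 + (v * d / R ^ 2) ^ 2 = v ^ 2 / R ^ 2 := by
        have : R ≠ 0 := hR.ne'
        field_simp
        rw [hRr]
      rw [this, one_pow, div_lt_one (by positivity)]
      exact hv
    · simp only [hB]
      congr 3
      simp only [WithLp.toLp_fst, WithLp.toLp_snd]
      rw [mul_left_comm, hγγ, mul_one, Complex.ofReal_re]
      have : R ≠ 0 := hR.ne'
      field_simp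
      rw [hRr]

end GenQuadratic

open GenQuadratic in
theorem mainTheorem3 (a b c : ℂ) (d : ℝ) (hd : 0 < d) :
    closure (GenQuadratic.E a b c d) = GenQuadratic.W a b c (d : ℂ) ∧
    (‖c‖ ≠ 1 →
      a ∈ interior (GenQuadratic.W a b c (d : ℂ)) ∧
      b ∈ interior (GenQuadratic.W a b c (d : ℂ)) ∧
      interior (GenQuadratic.W a b c (d : ℂ)) = GenQuadratic.E a b c d ∧
      ∀ s : ℂ, s ^ 2 = (a - b) ^ 2 + 4 * c * (d : ℂ) ^ 2 →
        GenQuadratic.IsOpenEllipticalDisk (GenQuadratic.E a b c d)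
          ((a + b + s) / 2) ((a + b - s) / 2)
          (GenQuadratic.semiMinor a b c d) (GenQuadratic.semiMajor a b c d)) ∧
    (a ≠ b → c = (a - b) ^ 2 / ((‖a - b‖ ^ 2 : ℝ) : ℂ) →
      GenQuadratic.E a b c d =
        openSegment ℝ
          ((a + b + (a - b) * ((√(1 + 4 * (1 / ‖a - b‖ ^ 2) * d ^ 2) : ℝ) : ℂ)) / 2)
          ((a + b - (a - b) * ((√(1 + 4 * (1 / ‖a - b‖ ^ 2) * d ^ 2) : ℝ) : ℂ)) / 2)) ∧
    (a = b → ‖c‖ = 1 →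
      ∀ r : ℂ, r ^ 2 = c →
        GenQuadratic.E a b c d = openSegment ℝ (a + (d : ℂ) * r) (a - (d : ℂ) * r)) ∧
    (a ≠ b → ‖c‖ = 1 → c ≠ (a - b) ^ 2 / ((‖a - b‖ ^ 2 : ℝ) : ℂ) →
      a ∈ frontier (GenQuadratic.W a b c (d : ℂ)) ∧
      b ∈ frontier (GenQuadratic.W a b c (d : ℂ)) ∧
      GenQuadratic.E a b c d = interior (GenQuadratic.W a b c (d : ℂ)) ∪ {a, b} ∧
      (∀ s : ℂ, s ^ 2 = (a - b) ^ 2 + 4 * c * (d : ℂ) ^ 2 →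
        GenQuadratic.IsEllipticalDisk (GenQuadratic.E a b c d)
          ((a + b + s) / 2) ((a + b - s) / 2)
          (GenQuadratic.semiMinor a b c d) (GenQuadratic.semiMajor a b c d)) ∧
      ¬ IsOpen (GenQuadratic.E a b c d) ∧
      ¬ IsClosed (GenQuadratic.E a b c d)) := by
  refine ⟨closure_E a b c hd, fun hc => ?_, fun hab hc => ?_, fun hab hc r hr => ?_,
    fun hab hc hne => ?_⟩
  · have h := nonDegenerate_of_norm_ne_one a b hd hc
    have hneg : -((1 - ‖c‖) ^ 2 * d ^ 2) / 2 < 0 := by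
      have := sub_ne_zero.2 hc.symm
      rw [neg_div, neg_lt_zero]
      positivity
    have ha : a ∈ ballPart a b c d :=
      (mem_ballPart_iff h a).2 ((ellipseDefect_left a b c d).trans_lt hneg)
    have hb : b ∈ ballPart a b c d :=
      (mem_ballPart_iff h b).2 ((ellipseDefect_right a b c d).trans_lt hneg)
    have hE : E a b c d = ballPart a b c d := by
      rw [E_eq a b c hd, Set.union_eq_left]
      rintro z (rfl | rfl) <;> assumption
    rw [interior_W h, hE]
    exact ⟨ha, hb, rfl, fun s hs => isOpenEllipticalDisk_ballPart h hs⟩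
  · have hn : 0 < ‖a - b‖ := norm_pos_iff.2 (sub_ne_zero.2 hab)
    have hn' : (‖a - b‖ : ℂ) ≠ 0 := by exact_mod_cast hn.ne'
    have hq : 0 < 1 + 4 * (1 / ‖a - b‖ ^ 2) * d ^ 2 := by positivity
    -- Here `γ` is the direction of the segment from `b` to `a`.
    rw [E_eq_openSegment (γ := (a - b) / ‖a - b‖) (r := ‖a - b‖ / 2)
      (R := ‖a - b‖ / 2 * √(1 + 4 * (1 / ‖a - b‖ ^ 2) * d ^ 2)) hd]
    · congr 1
      · push_cast
        field_simp
      · push_cast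
        field_simp
    · rw [norm_div, Complex.norm_real, norm_norm, div_self hn.ne']
    · rw [hc, div_pow]
      push_cast
      rfl
    · push_cast
      field_simp
    · positivity
    · rw [mul_pow, Real.sq_sqrt hq.le]
      field_simp
      ring
  · subst hab
    have hr1 : ‖r‖ = 1 := by
      rw [← sq_eq_sq₀ (norm_nonneg _) zero_le_one, ← norm_pow, hr, hc, one_pow]
    rw [E_eq_openSegment (r := 0) (R := d) hd hr1 hr.symm (by simp) hd (by ring),
      add_self_div_two]
  · have h := nonDegenerate_of_ne hd hab hc hne
    have ha0 : ellipseDefect a b c d a = 0 := by rw [ellipseDefect_left, hc]; ring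
    have hb0 : ellipseDefect a b c d b = 0 := by rw [ellipseDefect_right, hc]; ring
    have hfr {z : ℂ} (hz : ellipseDefect a b c d z = 0) : z ∈ frontier (W a b c d) := by
      refine ⟨subset_closure ((mem_W_iff a b c z d).2 hz.le), ?_⟩
      rw [interior_W h, mem_ballPart_iff h, hz]
      exact lt_irrefl _
    have hE : E a b c d = interior (W a b c d) ∪ {a, b} := by
      rw [interior_W h, E_eq a b c hd]
    refine ⟨hfr ha0, hfr hb0, hE, fun s hs => isEllipticalDisk_E hd h hs, fun ho => ?_,
      fun hcl => ?_⟩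
    -- An open `E` would lie in the interior of `W`, which does not contain `a`.
    · have haE : a ∈ E a b c d := by rw [hE]; simp
      refine (hfr ha0).2 (interior_maximal ?_ ho haE)
      rw [← closure_E a b c hd]
      exact subset_closure
    -- A closed `E` would be all of `W`, which has boundary points besides `a` and `b`.
    · obtain ⟨p, hpa, hpb, hp⟩ := exists_ellipseDefect_eq_zero hd hc hne
      have hpE : p ∈ E a b c d := by
        rw [← hcl.closure_eq, closure_E a b c hd]
        exact (mem_W_iff a b c p d).2 hp.le
      rw [hE] at hpE
      rcases hpE with hi | rfl | rfl
      · exact (hfr hp).2 hi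
      · exact hpa rfl
      · exact hpb rfl
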